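/- For an integer $m\ge 0$ let $\mathbb{P}^m_{\mathbb{C}}=(\mathbb{C}^{m+1}\setminus\{0\})/\mathbb{C}^*$, with the quotient topology, and let $PSL_{m+1}(\mathbb{C})$, the quotient of $SL_{m+1}(\mathbb{C})$ by its center (the scalar matrices $\alpha I$ with $\alpha^{m+1}=1$), act on it by projective transformations. A subgroup $\Gamma\le PSL_{m+1}(\mathbb{C})$ is called a Schottky group acting on $\mathbb{P}^m_{\mathbb{C}}$ if, for some integer $g\ge 2$, 1. there are $2g$ open sets $R_1,\dots,R_g,S_1,\dots,S_g$ in $\mathbb{P}^m_{\mathbb{C}}$, each of which is the interior of its closure, and whose closures are pairwise disjoint; and 2. $\Gamma$ is generated by elements $\gamma_1,\dots,\gamma_g$ such that $\gamma_j(R_j)=\mathbb{P}^m_{\mathbb{C}}\setminus\overline{S_j}$ for all $1\le j\le g$. **Theorem.** Let $n\ge 0$ be an integer. If $\Gamma\le PSL_{2n+1}(\mathbb{C})$ is a discrete subgroup, then $\Gamma$ is not a Schottky group acting on $\mathbb{P}^{2n}_{\mathbb{C}}$. -/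

import Mathlib

open scoped LinearAlgebra.Projectivization MatrixGroups

/-- The complex projective space `ℙ^m`: lines through the origin of `ℂ^(m+1)`. -/
abbrev CProj (m : ℕ) : Type := ℙ ℂ (Fin (m + 1) → ℂ)

/-- The topology of `ℙ^m`: the quotient topology for the projection `v ↦ [v]` from
`ℂ^(m+1) ∖ {0}`. -/
noncomputable instance CProj.instTopologicalSpace (m : ℕ) : TopologicalSpace (CProj m) :=
  TopologicalSpace.coinduced
    (fun v : {v : Fin (m + 1) → ℂ // v ≠ 0} => Projectivization.mk ℂ v.1 v.2) inferInstance

/-- A subgroup `Γ` of `PSL(m + 1, ℂ)` is a Schottky group acting on `ℙ^m` if, for some `g ≥ 2`,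
there are `2 g` open sets `R_1, …, R_g, S_1, …, S_g` of `ℙ^m`, each of them the interior of its
closure and with pairwise disjoint closures, and generators `γ_1, …, γ_g` of `Γ` such that
`γ_j` maps `R_j` onto the complement of the closure of `S_j`. -/
def IsSchottky {m : ℕ} (Γ : Subgroup PSL(m + 1, ℂ)) : Prop :=
  ∃ g : ℕ, 2 ≤ g ∧ ∃ (R S : Fin g → Set (CProj m)) (γ : Fin g → PSL(m + 1, ℂ)),
    (∀ j, IsOpen (R j)) ∧ (∀ j, IsOpen (S j)) ∧
    (∀ j, interior (closure (R j)) = R j) ∧ (∀ j, interior (closure (S j)) = S j) ∧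
    (∀ i j, i ≠ j → Disjoint (closure (R i)) (closure (R j))) ∧
    (∀ i j, i ≠ j → Disjoint (closure (S i)) (closure (S j))) ∧
    (∀ i j, Disjoint (closure (R i)) (closure (S j))) ∧
    Subgroup.closure (Set.range γ) = Γ ∧
    ∀ j, (fun x : CProj m => γ j • x) '' R j = (closure (S j))ᶜ

open Filter Topology

/-! Put `N = 2n+1`. Since `γ_j` sends `R_j` onto the complement of `closure S_j`, it maps `closure
S_j` into `S_j`. By `exists_dominated_splitting` this gives subspaces of complementary dimensions
`u_j + w_j = N`, projectively inside `S_j` and `R_j`. Disjoint closures force subspaces in different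
sets to meet trivially, so `u_1+u_2`, `w_1+w_2`, `w_1+u_2`, `u_1+w_2` are all at most `N`. The sums
`u_j + w_j = N` turn these into equalities, whence `2 w_1 = N`, which is odd. -/

/-! ### Linear algebra: perturbed spectra and absorbed cones. -/

/-- Take `D` diagonal with entries `1, …, n` along a flag that triangularizes `f`. The distinct
slopes `i + 1` later separate the moduli. -/
theorem Module.End.exists_perturbation_eigenvalues (n : ℕ) :
    ∀ (V : Type*) [AddCommGroup V] [Module ℂ V] [FiniteDimensional ℂ V],
      Module.finrank ℂ V = n → ∀ f : Module.End ℂ V, ∃ (D : Module.End ℂ V) (a : ℕ → ℂ),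
        ∀ t : ℂ, ∀ i < n, (f + t • D).HasEigenvalue (a i + t * (i + 1)) := by
  induction n with
  | zero => intro V _ _ _ _ f; exact ⟨0, 0, by simp⟩
  | succ n ih =>
    intro V _ _ _ hV f
    have : Nontrivial V := Module.nontrivial_of_finrank_pos (R := ℂ) (by omega)
    obtain ⟨μ, hμ⟩ := Module.End.exists_eigenvalue f
    have hker (g : Module.End ℂ V) (ν : ℂ) : g.HasEigenvalue ν ↔
        LinearMap.range (g - algebraMap ℂ (Module.End ℂ V) ν) < ⊤ := by
      rw [lt_top_iff_ne_top, Ne, ← LinearMap.ker_eq_bot_iff_range_eq_top,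
        Module.End.hasEigenvalue_iff, Module.End.eigenspace_def, Algebra.algebraMap_eq_smul_one]
    -- `φ` is a left eigenvector of `f`, so its kernel is an invariant hyperplane for the induction.
    obtain ⟨φ, hφ, hle⟩ := Submodule.exists_le_ker_of_lt_top _ ((hker f μ).1 hμ)
    have hφf (x : V) : φ (f x) = μ * φ x := by
      have := hle (LinearMap.mem_range_self _ x)
      simpa [sub_eq_zero] using this
    obtain ⟨w, hw⟩ : ∃ w, φ w = 1 := LinearMap.surjective hφ 1
    have hH : Module.finrank ℂ (LinearMap.ker φ) = n := by
      have := Module.Dual.finrank_ker_add_one_of_ne_zero hφ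
      omega
    have hinv : ∀ x ∈ LinearMap.ker φ, f x ∈ LinearMap.ker φ := by
      intro x hx
      rw [LinearMap.mem_ker] at hx ⊢
      rw [hφf, hx, mul_zero]
    obtain ⟨D, a, hD⟩ := ih _ hH (f.restrict hinv)
    let p : V →ₗ[ℂ] LinearMap.ker φ :=
      (LinearMap.id - φ.smulRight w).codRestrict _ (by intro x; simp [hw])
    have hp (x : LinearMap.ker φ) : p x = x := by
      refine Subtype.ext (show (x : V) - φ x • w = x from ?_)
      rw [LinearMap.mem_ker.1 x.2, zero_smul, sub_zero]
    let E : Module.End ℂ V := (LinearMap.ker φ).subtype ∘ₗ D ∘ₗ p + ((n : ℂ) + 1) • φ.smulRight w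
    have hEφ (x : V) : φ (E x) = (n + 1) * φ x := by
      have := (D (p x)).2
      rw [LinearMap.mem_ker] at this
      simp [E, this, hw]
    have hEH (x : LinearMap.ker φ) : E x = D x := by
      simp [E, hp]
    refine ⟨E, fun i => if i < n then a i else μ, fun t i hi => ?_⟩
    beta_reduce
    rcases Nat.lt_succ_iff_lt_or_eq.1 hi with h | rfl
    · obtain ⟨v, hv⟩ := (hD t i h).exists_hasEigenvector
      have h1 := congrArg Subtype.val hv.apply_eq_smul
      rw [if_pos h]
      refine Module.End.hasEigenvalue_of_hasEigenvector (x := (v : V))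
        (Module.End.hasEigenvector_iff.2 ⟨Module.End.mem_eigenspace_iff.2 ?_, ?_⟩)
      · simpa [hEH] using h1
      · simpa using hv.2
    · rw [hker, if_neg (lt_irrefl _)]
      refine lt_of_le_of_lt (b := LinearMap.ker φ) ?_ ?_
      · rintro _ ⟨x, rfl⟩
        simp [hφf, hEφ]
        ring
      · rw [lt_top_iff_ne_top, Ne, LinearMap.ker_eq_top]
        exact hφ

theorem eventually_quadratic_ne_zero (a b c : ℝ) (hc : c ≠ 0) :
    ∀ᶠ t in 𝓝[≠] (0 : ℝ), a + b * t + c * t ^ 2 ≠ 0 := by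
  set p : Polynomial ℝ := .C a + .C b * .X + .C c * .X ^ 2
  have hp : p ≠ 0 := by
    intro h
    have := congrArg (fun q => Polynomial.coeff q 2) h
    simp [p] at this
    exact hc this
  have : (p.roots.toFinset : Set ℝ)ᶜ ∈ 𝓝[≠] (0 : ℝ) :=
    nhdsNE_le_cofinite _ (Finset.finite_toSet _).compl_mem_cofinite
  filter_upwards [this] with t ht h
  apply ht
  simp [hp, p, h]

/-- Power iteration: among the coordinates occurring in `x`, the one with the largest `‖l i‖`
survives. -/
theorem tendsto_dominant_eigenvector {V ι : Type*} [NormedAddCommGroup V] [NormedSpace ℂ V]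
    [Fintype ι] (e : Module.Basis ι ℂ V) (f : V →ₗ[ℂ] V) (l : ι → ℂ) (hl : ∀ i, l i ≠ 0)
    (hinj : Function.Injective fun i => ‖l i‖) (hf : ∀ i, f (e i) = l i • e i)
    (I : Set ι) (x : V) (hx : x ∈ Submodule.span ℂ (e '' I)) (hx0 : x ≠ 0) :
    ∃ i ∈ I, ∃ c : ℂ, c ≠ 0 ∧
      Tendsto (fun k : ℕ => ((l i)⁻¹ ^ k) • (f ^ k) x) atTop (𝓝 (c • e i)) := by
  classical
  rw [e.mem_span_image] at hx
  have hne : (e.repr x).support.Nonempty := by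
    rw [Finsupp.support_nonempty_iff]
    simpa using hx0
  obtain ⟨i, hi, hmax⟩ := Finset.exists_max_image _ (fun i => ‖l i‖) hne
  refine ⟨i, hx hi, e.repr x i, by simpa using hi, ?_⟩
  have hpow (k : ℕ) (j : ι) : (f ^ k) (e j) = l j ^ k • e j := by
    induction k with
    | zero => simp
    | succ k ih => rw [pow_succ', Module.End.mul_apply, ih, map_smul, hf, smul_smul, pow_succ]
  have hsum (k : ℕ) : ((l i)⁻¹ ^ k) • (f ^ k) x = ∑ j, ((l j / l i) ^ k * e.repr x j) • e j := by
    conv_lhs => rw [← e.sum_repr x]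
    simp only [map_sum, map_smul, hpow, Finset.smul_sum, smul_smul]
    refine Finset.sum_congr rfl fun j _ => ?_
    rw [div_eq_mul_inv, mul_pow]
    ring_nf
  have hlim : e.repr x i • e i = ∑ j, (if j = i then e.repr x i else 0) • e j := by
    simp [ite_smul]
  simp only [hsum]
  rw [hlim]
  refine tendsto_finsetSum _ fun j _ => Tendsto.smul_const ?_ _
  split_ifs with h
  · subst h
    simp [div_self (hl j)]
  · by_cases h0 : e.repr x j = 0
    · simp [h0]
    · have hlt : ‖l j‖ < ‖l i‖ :=
        lt_of_le_of_ne (hmax j (by simpa using h0)) fun h' => h (hinj h')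
      have : Tendsto (fun k : ℕ => (l j / l i) ^ k) atTop (𝓝 0) := by
        apply tendsto_pow_atTop_nhds_zero_of_norm_lt_one
        rw [norm_div, div_lt_one (norm_pos_iff.2 (hl i))]
        exact hlt
      simpa using this.mul_const (e.repr x j)

/-- If an open invariant multicone `P` strictly absorbs the closed multicone `C`, the space splits into a
subspace inside `P` and one avoiding `C`: perturb `A` so that its eigenvalues have distinct moduli. -/
theorem exists_dominated_splitting {V : Type*} [NormedAddCommGroup V] [NormedSpace ℂ V]
    [FiniteDimensional ℂ V] (A : V →ₗ[ℂ] V) (P C : Set V) (hP : IsOpen P)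
    (hC : IsClosed (insert 0 C)) (hC0 : (0 : V) ∉ C) (hPC : P ⊆ C)
    (hPs : ∀ c : ℂ, c ≠ 0 → ∀ v ∈ P, c • v ∈ P) (hCs : ∀ c : ℂ, c ≠ 0 → ∀ v ∈ C, c • v ∈ C)
    (hA : ∀ v ∈ C, A v ∈ P) :
    ∃ W₁ W₂ : Submodule ℂ V,
      Module.finrank ℂ W₁ + Module.finrank ℂ W₂ = Module.finrank ℂ V ∧
      (∀ v ∈ W₁, v ≠ 0 → v ∈ P) ∧ ∀ v ∈ W₂, v ∉ C := by
  classical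
  have : ProperSpace V := FiniteDimensional.proper ℂ V
  obtain ⟨D, a, hD⟩ := Module.End.exists_perturbation_eigenvalues _ V rfl A
  have hK : IsCompact (insert 0 C ∩ Metric.sphere 0 1) := (isCompact_sphere 0 1).inter_left hC
  -- Absorption is an open condition on a compact set of unit vectors, so it survives small `t`.
  have h1 : ∀ᶠ t : ℝ in 𝓝[≠] 0, ∀ v ∈ insert 0 C ∩ Metric.sphere 0 1, (A + (t : ℂ) • D) v ∈ P := by
    refine Filter.Eventually.filter_mono nhdsWithin_le_nhds
      (hK.eventually_forall_of_forall_eventually fun v hv => ?_)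
    have hcont : Continuous fun z : ℝ × V => (A + (z.1 : ℂ) • D) z.2 := by
      have hAc := A.continuous_of_finiteDimensional
      have hDc := D.continuous_of_finiteDimensional
      simp only [LinearMap.add_apply, LinearMap.smul_apply]
      fun_prop
    refine hcont.continuousAt.eventually_mem (hP.mem_nhds ?_)
    have : v ∈ C := hv.1.resolve_left fun h => by simp [h] at hv
    simpa using hA v this
  -- The leading coefficients `(i + 1) ^ 2` differ, so moduli coincide for only finitely many `t`.
  have hsq (t : ℝ) (i : ℕ) : ‖a i + t * (i + 1)‖ ^ 2 =
      ‖a i‖ ^ 2 + 2 * (a i).re * (i + 1) * t + (i + 1) ^ 2 * t ^ 2 := by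
    rw [← Complex.normSq_eq_norm_sq, ← Complex.normSq_eq_norm_sq, Complex.normSq_apply,
      Complex.normSq_apply]
    simp
    ring
  have h2 : ∀ᶠ t : ℝ in 𝓝[≠] 0, ∀ i : Fin (Module.finrank ℂ V), a i + t * (i + 1) ≠ 0 := by
    refine eventually_all.2 fun i => ?_
    filter_upwards [eventually_quadratic_ne_zero (‖a i‖ ^ 2) (2 * (a i).re * (i + 1))
      ((i + 1) ^ 2) (by positivity)] with t ht h
    exact ht (by rw [← hsq, h]; simp)
  have h3 : ∀ᶠ t : ℝ in 𝓝[≠] 0, ∀ i j : Fin (Module.finrank ℂ V), i ≠ j →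
      ‖a i + t * (i + 1)‖ ≠ ‖a j + t * (j + 1)‖ := by
    refine eventually_all.2 fun i => eventually_all.2 fun j => ?_
    by_cases hij : i = j
    · exact .of_forall fun _ h => absurd hij h
    have hne : ((i : ℝ) + 1) ^ 2 - (j + 1) ^ 2 ≠ 0 := by
      rw [sub_ne_zero, Ne, sq_eq_sq₀ (by positivity) (by positivity), add_left_inj, Nat.cast_inj]
      exact fun h => hij (Fin.ext h)
    filter_upwards [eventually_quadratic_ne_zero (‖a i‖ ^ 2 - ‖a j‖ ^ 2)
      (2 * (a i).re * (i + 1) - 2 * (a j).re * (j + 1)) _ hne] with t ht _ h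
    apply ht
    have := hsq t i
    have := hsq t j
    rw [h] at *
    linarith
  obtain ⟨t, h1, h2, h3⟩ := (h1.and (h2.and h3)).exists
  set B : Module.End ℂ V := A + (t : ℂ) • D
  set l : Fin (Module.finrank ℂ V) → ℂ := fun i => a i + t * (i + 1)
  have hinj : Function.Injective fun i => ‖l i‖ := fun i j h => by
    by_contra hij
    exact h3 i j hij h
  have hB (i : Fin (Module.finrank ℂ V)) : ∃ v, B.HasEigenvector (l i) v :=
    (hD t i i.2).exists_hasEigenvector
  choose v hv using hB
  have hli : LinearIndependent ℂ v := Module.End.eigenvectors_linearIndependent' B l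
    (fun i j h => hinj (congrArg norm h)) v hv
  let e : Module.Basis (Fin (Module.finrank ℂ V)) ℂ V :=
    basisOfLinearIndependentOfCardEqFinrank' v hli (by simp)
  have hev (i) : e i = v i := by simp [e]
  have hBe (i) : B (e i) = l i • e i := by rw [hev]; exact (hv i).apply_eq_smul
  have he0 (i) : e i ≠ 0 := e.ne_zero i
  have hBC : ∀ v ∈ C, B v ∈ P := by
    intro v hvC
    have hv0 : v ≠ 0 := fun h => hC0 (h ▸ hvC)
    have hn : (‖v‖ : ℂ) ≠ 0 := by simpa using hv0
    have := h1 ((‖v‖ : ℂ)⁻¹ • v) ⟨Or.inr (hCs _ (inv_ne_zero hn) _ hvC), by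
      simp [norm_smul, hv0]⟩
    have := hPs _ hn _ this
    rwa [map_smul, smul_smul, mul_inv_cancel₀ hn, one_smul] at this
  have hBCk (k : ℕ) : ∀ v ∈ C, (B ^ k) v ∈ C := by
    induction k with
    | zero => simp
    | succ k ih =>
      intro v hv
      rw [pow_succ', Module.End.mul_apply]
      exact hPC (hBC _ (ih v hv))
  let I : Set (Fin (Module.finrank ℂ V)) := {i | e i ∈ P}
  have hIc (i) (hi : i ∉ I) : e i ∉ C := by
    intro h
    have := hPs _ (inv_ne_zero (h2 i)) _ (hBC _ h)
    rw [hBe, smul_smul, inv_mul_cancel₀ (h2 i), one_smul] at this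
    exact hi this
  have hfin (J : Set (Fin (Module.finrank ℂ V))) :
      Module.finrank ℂ (Submodule.span ℂ (e '' J)) = J.ncard := by
    have := finrank_span_eq_card (R := ℂ) (e.linearIndependent.comp ((↑) : J → _)
      Subtype.val_injective)
    rwa [Set.range_comp, Subtype.range_coe, Fintype.card_eq_nat_card, Nat.card_coe_set_eq] at this
  refine ⟨Submodule.span ℂ (e '' I), Submodule.span ℂ (e '' Iᶜ), ?_, ?_, ?_⟩
  · rw [hfin, hfin, Set.ncard_add_ncard_compl]
    simp
  · intro x hx hx0
    -- Backward iterates of `x` under `G = B⁻¹` approach an eigenline in `P`, hence enter `P`;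
    -- applying `B` as often returns to `x` within `P`.
    let G : V →ₗ[ℂ] V := e.constr ℂ fun i => (l i)⁻¹ • e i
    have hG (i) : G (e i) = (l i)⁻¹ • e i := by simp [G]
    have hBG : B * G = 1 := e.ext fun i => by
      rw [Module.End.mul_apply, hG, map_smul, hBe, smul_smul, inv_mul_cancel₀ (h2 i)]
      simp
    have hGB : G * B = 1 := e.ext fun i => by
      rw [Module.End.mul_apply, hBe, map_smul, hG, smul_smul, mul_inv_cancel₀ (h2 i)]
      simp
    obtain ⟨i, hi, c, hc, hlim⟩ := tendsto_dominant_eigenvector e G (fun i => (l i)⁻¹)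
      (fun i => inv_ne_zero (h2 i)) (fun i j h => hinj (by simpa using h)) hG I x hx hx0
    obtain ⟨k, hk0, hk⟩ := ((eventually_ge_atTop 1).and
      (hlim.eventually_mem (hP.mem_nhds (hPs c hc _ hi)))).exists
    have hk := hPs _ (inv_ne_zero (pow_ne_zero k (inv_ne_zero (inv_ne_zero (h2 i))))) _ hk
    rw [smul_smul, inv_mul_cancel₀ (pow_ne_zero k (inv_ne_zero (inv_ne_zero (h2 i)))),
      one_smul] at hk
    obtain ⟨k, rfl⟩ := Nat.exists_eq_add_of_le' hk0
    have hk' := hBC _ (hBCk k _ (hPC hk))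
    rwa [← Module.End.mul_apply, ← Module.End.mul_apply, ← pow_succ',
      ← (show Commute B G from hBG.trans hGB.symm).mul_pow, hBG, one_pow] at hk'
  · intro x hx hxC
    -- Forward iterates stay in `C`, so their nonzero limit would be an eigenvector in `C` with
    -- index outside `I`.
    obtain ⟨i, hi, c, hc, hlim⟩ := tendsto_dominant_eigenvector e B l h2 hinj hBe Iᶜ x hx
      (fun h => hC0 (h ▸ hxC))
    have := hC.mem_of_tendsto hlim (.of_forall fun k =>
      Or.inr (hCs _ (pow_ne_zero k (inv_ne_zero (h2 i))) _ (hBCk k x hxC)))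
    have := hCs _ (inv_ne_zero hc) _ (this.resolve_left (smul_ne_zero hc (he0 i)))
    rw [smul_smul, inv_mul_cancel₀ hc, one_smul] at this
    exact hIc i hi this

/-! ### Projective sets as cones, and the Schottky pairing. -/

/-- The set of nonzero vectors whose class lies in a given subset of `ℙ^m`. -/
def CProj.cone {m : ℕ} (X : Set (CProj m)) : Set (Fin (m + 1) → ℂ) :=
  {v | ∃ h : v ≠ 0, Projectivization.mk ℂ v h ∈ X}

namespace CProj

variable {m : ℕ}

theorem smul_mem_cone {X : Set (CProj m)} {c : ℂ} (hc : c ≠ 0) {v : Fin (m + 1) → ℂ}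
    (hv : v ∈ cone X) : c • v ∈ cone X := by
  obtain ⟨h, hX⟩ := hv
  refine ⟨smul_ne_zero hc h, ?_⟩
  convert hX using 1
  rw [Projectivization.mk_eq_mk_iff']
  exact ⟨c, rfl⟩

theorem isOpen_cone {X : Set (CProj m)} (hX : IsOpen X) : IsOpen (cone X) := by
  have h := (isOpen_coinduced.1 hX : IsOpen ((fun v : {v : Fin (m + 1) → ℂ // v ≠ 0} =>
    Projectivization.mk ℂ v.1 v.2) ⁻¹' X))
  convert isOpen_ne.isOpenMap_subtype_val _ h
  ext v
  simp [cone]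

theorem isClosed_insert_zero_cone {X : Set (CProj m)} (hX : IsClosed X) :
    IsClosed (insert 0 (cone X)) := by
  rw [← isOpen_compl_iff]
  convert isOpen_cone hX.isOpen_compl
  ext v
  by_cases hv : v = 0 <;> simp [cone, hv]

theorem smul_mk (g : Matrix.SpecialLinearGroup (Fin (m + 1)) ℂ) {v : Fin (m + 1) → ℂ}
    (hv : v ≠ 0) (hgv : Matrix.SpecialLinearGroup.toLin' g v ≠ 0) :
    (QuotientGroup.mk g : PSL(m + 1, ℂ)) • (Projectivization.mk ℂ v hv : CProj m) =
      Projectivization.mk ℂ (Matrix.SpecialLinearGroup.toLin' g v) hgv :=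
  rfl

theorem continuous_smul (γ : PSL(m + 1, ℂ)) : Continuous fun x : CProj m => γ • x := by
  obtain ⟨g, rfl⟩ := QuotientGroup.mk_surjective γ
  rw [continuous_coinduced_dom]
  have hne (v : {v : Fin (m + 1) → ℂ // v ≠ 0}) :
      Matrix.SpecialLinearGroup.toLin' g v.1 ≠ 0 := by simpa using v.2
  have hc : Continuous (Matrix.SpecialLinearGroup.toLin' g) :=
    (Matrix.SpecialLinearGroup.toLin' g).toLinearMap.continuous_of_finiteDimensional
  have h : Continuous fun v : {v : Fin (m + 1) → ℂ // v ≠ 0} =>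
      (⟨Matrix.SpecialLinearGroup.toLin' g v.1, hne v⟩ : {v : Fin (m + 1) → ℂ // v ≠ 0}) :=
    (hc.comp continuous_subtype_val).subtype_mk _
  exact continuous_coinduced_rng.comp h

/-- The points that `γ⁻¹` sends outside `closure R` form an open subset of `closure S`, hence lie in
its interior `S`. -/
theorem smul_closure_subset {R S : Set (CProj m)} (hS : interior (closure S) = S)
    (hRS : Disjoint (closure R) (closure S)) (γ : PSL(m + 1, ℂ))
    (hγ : (fun x : CProj m => γ • x) '' R = (closure S)ᶜ) {x : CProj m} (hx : x ∈ closure S) :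
    γ • x ∈ S := by
  rw [← hS, mem_interior]
  refine ⟨(fun y : CProj m => γ⁻¹ • y) ⁻¹' (closure R)ᶜ, fun y hy => ?_,
    isClosed_closure.isOpen_compl.preimage (continuous_smul _), ?_⟩
  · by_contra hyS
    obtain ⟨r, hr, rfl⟩ := hγ.symm.subset hyS
    exact hy (by simpa using subset_closure hr)
  · simpa using fun h => hRS.notMem_of_mem_left h hx

theorem exists_submodules_of_pairing {R S : Set (CProj m)} (hSo : IsOpen S)
    (hS : interior (closure S) = S)
    (hRS : Disjoint (closure R) (closure S)) (γ : PSL(m + 1, ℂ))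
    (hγ : (fun x : CProj m => γ • x) '' R = (closure S)ᶜ) :
    ∃ W₁ W₂ : Submodule ℂ (Fin (m + 1) → ℂ),
      Module.finrank ℂ W₁ + Module.finrank ℂ W₂ = m + 1 ∧
      (∀ v ∈ W₁, v ≠ 0 → v ∈ cone S) ∧ ∀ v ∈ W₂, v ≠ 0 → v ∈ cone R := by
  have hmaps := fun x => smul_closure_subset hS hRS γ hγ (x := x)
  obtain ⟨g, rfl⟩ := QuotientGroup.mk_surjective γ
  have hne {v : Fin (m + 1) → ℂ} (hv : v ≠ 0) : Matrix.SpecialLinearGroup.toLin' g v ≠ 0 := by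
    simpa using hv
  obtain ⟨W₁, W₂, hfin, h₁, h₂⟩ := exists_dominated_splitting
    (Matrix.SpecialLinearGroup.toLin' g).toLinearMap (cone S) (cone (closure S))
    (isOpen_cone hSo) (isClosed_insert_zero_cone isClosed_closure) (fun h => h.1 rfl)
    (fun v ⟨h, hv⟩ => ⟨h, subset_closure hv⟩) (fun c hc v hv => smul_mem_cone hc hv)
    (fun c hc v hv => smul_mem_cone hc hv) (fun v ⟨h, hv⟩ => ⟨hne h, hmaps _ hv⟩)
  -- `W₂` only avoids `closure S`; pulling it back by `γ` puts it in `R`.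
  refine ⟨W₁, W₂.map (Matrix.SpecialLinearGroup.toLin' g).symm.toLinearMap, ?_, h₁, ?_⟩
  · rw [LinearEquiv.finrank_map_eq, hfin]
    simp
  · rintro _ ⟨w, hw, rfl⟩ hv
    refine ⟨hv, ?_⟩
    have hmem : (QuotientGroup.mk g : PSL(m + 1, ℂ)) • (Projectivization.mk ℂ _ hv : CProj m) ∈
        (closure S)ᶜ := fun hcl => h₂ w hw (by
      rw [smul_mk g hv (hne hv)] at hcl
      have : w ≠ 0 := by rintro rfl; simp at hv
      exact ⟨this, by simpa using hcl⟩)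
    obtain ⟨r, hr, hrv⟩ := hγ.symm.subset hmem
    rwa [← MulAction.injective _ hrv]

theorem disjoint_of_cone {X Y : Set (CProj m)} (hXY : Disjoint (closure X) (closure Y))
    {U W : Submodule ℂ (Fin (m + 1) → ℂ)} (hU : ∀ v ∈ U, v ≠ 0 → v ∈ cone X)
    (hW : ∀ v ∈ W, v ≠ 0 → v ∈ cone Y) :
    Module.finrank ℂ U + Module.finrank ℂ W ≤ m + 1 := by
  have hd : Disjoint U W := by
    rw [Submodule.disjoint_def]
    intro v hvU hvW
    by_contra hv
    exact (hXY.mono subset_closure subset_closure).notMem_of_mem_left (hU v hvU hv).2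
      (hW v hvW hv).2
  simpa using Submodule.finrank_add_finrank_le_of_disjoint hd

end CProj

theorem theorem1 (n : ℕ) (Γ : Subgroup PSL(2 * n + 1, ℂ)) (hΓ : DiscreteTopology Γ) :
    ¬ IsSchottky (m := 2 * n) Γ := by
  rintro ⟨g, hg, R, S, γ, -, hSo, -, hS, hRR, hSS, hRS, -, hγ⟩
  have key (j : Fin g) := CProj.exists_submodules_of_pairing (hSo j) (hS j) (hRS j j) (γ j) (hγ j)
  have h01 : (⟨0, by omega⟩ : Fin g) ≠ ⟨1, by omega⟩ := by simp
  obtain ⟨U, W, hUW, hU, hW⟩ := key ⟨0, by omega⟩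
  obtain ⟨U', W', hUW', hU', hW'⟩ := key ⟨1, by omega⟩
  have h1 := CProj.disjoint_of_cone (hSS _ _ h01) hU hU'
  have h2 := CProj.disjoint_of_cone (hRR _ _ h01) hW hW'
  have h3 := CProj.disjoint_of_cone (hRS _ _) hW hU'
  have h4 := CProj.disjoint_of_cone (hRS _ _).symm hU hW'
  omega
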